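/- Let $\mathbb{N}$ be the set of nonnegative integers. A numerical semigroup is a subset $S\subseteq\mathbb{N}$ that contains $0$, is closed under addition and has finite complement in $\mathbb{N}$. Write $S^*=S\setminus\{0\}$, and let $P(S)=S^*\setminus(S^*+S^*)$ be the set of primitives (minimal generators) of $S$. Let $F(S)$ be the Frobenius number of $S$, i.e. the largest positive integer not in $S$, with the convention $F(\mathbb{N})=-1$, and let $L(S)=\{s\in S: s<F(S)\}$ be the set of left elements of $S$. One says that $S$ satisfies Wilf's conjecture if $|P(S)|\cdot|L(S)|\ge F(S)+1$; let $\mathcal{W}$ be the set of numerical semigroups that satisfy Wilf's conjecture. For a positive integer $n$ let $\mathcal{A}_n$ be the set of numerical semigroups $S$ with $\max P(S)=n$; it is finite, and it is non-empty for $n\neq 2$. For $n \ne 2$ and a set $Q$ of numerical semigroups let $\mathbb{P}_{\mathcal{A}_n}(Q)=|Q\cap\mathcal{A}_n|/|\mathcal{A}_n|$. **Theorem.** \[ \lim_{n\to\infty}\mathbb{P}_{\mathcal{A}_n}(\mathcal{W})=\lim_{n\to\infty}\frac{\left|\{S\in\mathcal{A}_n : |P(S)|\cdot|L(S)|>F(S)\}\right|}{|\mathcal{A}_n|}=1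 . \] -/

import Mathlib

namespace NumericalSemigroup

/-- The set of all numerical semigroups: the subsets of `ℕ` that contain `0`, are closed under
addition and have finite complement. -/
def all : Set (AddSubmonoid ℕ) :=
  {S | ((S : Set ℕ)ᶜ).Finite}

open scoped Pointwise in
/-- The primitives (minimal generators) of `S`: with `S* = S \ {0}`, the set `S* \ (S* + S*)`. -/
def primitives (S : AddSubmonoid ℕ) : Set ℕ :=
  ((S : Set ℕ) \ {0}) \ (((S : Set ℕ) \ {0}) + ((S : Set ℕ) \ {0}))

/-- The gaps of `S`: the positive integers that do not belong to `S`. -/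
def gaps (S : AddSubmonoid ℕ) : Set ℕ :=
  {x | 0 < x ∧ x ∉ S}

open Classical in
/-- The Frobenius number of a numerical semigroup `S`: its largest gap, and `-1` if `S = ℕ`. -/
noncomputable def frobeniusNumber (S : AddSubmonoid ℕ) : ℤ :=
  if S = ⊤ then -1 else ((sSup (gaps S) : ℕ) : ℤ)

/-- The left elements of `S`: the elements of `S` that are smaller than the Frobenius number. -/
def leftElements (S : AddSubmonoid ℕ) : Set ℕ :=
  {s | s ∈ S ∧ (s : ℤ) < frobeniusNumber S}

/-- The set of numerical semigroups that satisfy Wilf's conjecture, `|P(S)| · |L(S)| ≥ F(S) + 1`. -/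
def wilf : Set (AddSubmonoid ℕ) :=
  {S | S ∈ all ∧
    ((primitives S).ncard : ℤ) * ((leftElements S).ncard : ℤ) ≥ frobeniusNumber S + 1}

/-- The set of numerical semigroups whose maximum primitive is `n`. -/
def withMaxPrimitive (n : ℕ) : Set (AddSubmonoid ℕ) :=
  {S | S ∈ all ∧ IsGreatest (primitives S) n}

/-- The probability that a uniformly random numerical semigroup with maximum primitive `n`
belongs to `Q`. -/
noncomputable def probMaxPrimitive (n : ℕ) (Q : Set (AddSubmonoid ℕ)) : ℝ :=
  ((Q ∩ withMaxPrimitive n).ncard : ℝ) / ((withMaxPrimitive n).ncard : ℝ)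

end NumericalSemigroup

namespace NumericalSemigroup

/-! Let k = ⌊√(2n)⌋. If |P| > k and F ≥ n, put q = ⌊F/n⌋ ≥ 1: translating the primitives by
multiples of n gives |L| ≥ q|P|, so |P||L| ≥ q|P|² > 2qn ≥ (q+1)n > F. If F < n, failure of Wilf's
inequality forces |P| ≤ k or |L| ≤ k (`few_primitives_or_few_leftElements`).

A semigroup is determined by its primitives, and also by F together with L. The exceptions are thus
encoded by subsets of [0, n] of size at most k, in the second case paired with F, so there are only
exp(O(√n log n)) of them (`ncard_diff_wilf_le`). The whole family is exponentially large: any set of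
integers in (n/2, n-1), joined to n-1 and n, generates a different member
(`two_pow_le_ncard_withMaxPrimitive`). -/

open Finset in
theorem card_powerset_filter_card_le (n k : ℕ) :
    #{A ∈ (range (n + 1)).powerset | #A ≤ k} ≤ (k + 1) * (n + 1) ^ k := by
  have hsub : {A ∈ (range (n + 1)).powerset | #A ≤ k} ⊆
      (range (k + 1)).biUnion fun i => powersetCard i (range (n + 1)) := by
    intro A hA
    simp only [mem_filter, mem_powerset] at hA
    simp only [mem_biUnion, mem_range, mem_powersetCard]
    exact ⟨#A, by omega, hA.1, rfl⟩
  refine (card_le_card hsub).trans (card_biUnion_le.trans ?_)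
  have h : ∀ i ∈ range (k + 1), #(powersetCard i (range (n + 1))) ≤ (n + 1) ^ k := by
    intro i hi
    rw [card_powersetCard, card_range]
    exact (Nat.choose_le_pow _ _).trans
      (Nat.pow_le_pow_right n.succ_pos (Nat.lt_succ_iff.1 (mem_range.1 hi)))
  simpa using sum_le_card_nsmul _ _ _ h

/-! ### Primitives, left elements and failure of Wilf's inequality -/

theorem mem_primitives {S : AddSubmonoid ℕ} {x : ℕ} :
    x ∈ primitives S ↔
      x ∈ S ∧ x ≠ 0 ∧ ∀ a ∈ S, ∀ b ∈ S, a ≠ 0 → b ≠ 0 → a + b ≠ x := by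
  simp only [primitives, Set.mem_sdiff, Set.mem_add, SetLike.mem_coe, Set.mem_singleton_iff]
  constructor
  · rintro ⟨⟨h1, h2⟩, h3⟩
    exact ⟨h1, h2, fun a ha b hb ha0 hb0 hab => h3 ⟨a, ⟨ha, ha0⟩, b, ⟨hb, hb0⟩, hab⟩⟩
  · rintro ⟨h1, h2, h3⟩
    refine ⟨⟨h1, h2⟩, ?_⟩
    rintro ⟨a, ⟨ha, ha0⟩, b, ⟨hb, hb0⟩, hab⟩
    exact h3 a ha b hb ha0 hb0 hab

theorem closure_primitives (S : AddSubmonoid ℕ) : AddSubmonoid.closure (primitives S) = S := by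
  apply le_antisymm
  · rw [AddSubmonoid.closure_le]
    exact fun x hx => (mem_primitives.1 hx).1
  · intro x
    induction x using Nat.strong_induction_on with
    | _ x ih =>
      intro hx
      by_cases hp : x ∈ primitives S
      · exact AddSubmonoid.subset_closure hp
      by_cases hx0 : x = 0
      · exact hx0 ▸ zero_mem _
      rw [mem_primitives] at hp
      push Not at hp
      obtain ⟨a, ha, b, hb, ha0, hb0, rfl⟩ := hp hx hx0
      exact add_mem (ih a (by omega) ha) (ih b (by omega) hb)

theorem primitives_closure_subset (X : Set ℕ) : primitives (AddSubmonoid.closure X) ⊆ X := by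
  intro x hx
  rw [mem_primitives] at hx
  obtain ⟨hx, hx0, hx2⟩ := hx
  have key : x = 0 ∨ x ∈ X ∨ ∃ a ∈ AddSubmonoid.closure X, ∃ b ∈ AddSubmonoid.closure X,
      a ≠ 0 ∧ b ≠ 0 ∧ a + b = x := by
    clear hx0 hx2
    induction hx using AddSubmonoid.closure_induction with
    | mem x h => exact Or.inr (Or.inl h)
    | zero => exact Or.inl rfl
    | add x y hx hy ihx ihy =>
      rcases eq_or_ne x 0 with rfl | hx0
      · simpa using ihy
      rcases eq_or_ne y 0 with rfl | hy0
      · simpa using ihx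
      exact Or.inr (Or.inr ⟨x, hx, y, hy, hx0, hy0, rfl⟩)
  rcases key with h | h | ⟨a, ha, b, hb, ha0, hb0, hab⟩
  · exact absurd h hx0
  · exact h
  · exact absurd hab (hx2 a ha b hb ha0 hb0)

theorem exists_frobeniusNumber_eq {S : AddSubmonoid ℕ} (hS : S ∈ all) (hT : S ≠ ⊤) :
    ∃ f : ℕ, frobeniusNumber S = f ∧ f ∉ S ∧ ∀ x, f < x → x ∈ S := by
  have hfin : (gaps S).Finite := Set.Finite.subset hS fun x hx => hx.2
  have hne : (gaps S).Nonempty := by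
    by_contra h
    rw [Set.not_nonempty_iff_eq_empty] at h
    refine hT (eq_top_iff.2 fun x _ => ?_)
    by_contra hx
    have : x ∈ gaps S := ⟨Nat.pos_of_ne_zero fun h0 => hx (h0 ▸ zero_mem S), hx⟩
    simp [h] at this
  refine ⟨sSup (gaps S), by simp [frobeniusNumber, hT], (Nat.sSup_mem hne hfin.bddAbove).2, ?_⟩
  intro x hx
  by_contra h
  have := le_csSup hfin.bddAbove (show x ∈ gaps S from ⟨by omega, h⟩)
  omega

theorem finite_leftElements {S : AddSubmonoid ℕ} : (leftElements S).Finite := by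
  refine (Set.finite_Iio (frobeniusNumber S).toNat).subset fun x hx => ?_
  have := hx.2
  simp only [Set.mem_Iio]
  omega

/-- If the Frobenius number exceeds the generator `n`, translating the other primitives and `0` by
multiples of `n` produces many left elements. -/
theorem mul_ncard_primitives_le_ncard_leftElements {S : AddSubmonoid ℕ} {n q : ℕ}
    (hn : IsGreatest (primitives S) n) (hq : ((q * n : ℕ) : ℤ) ≤ frobeniusNumber S) :
    q * (primitives S).ncard ≤ (leftElements S).ncard := by
  have hnS := mem_primitives.1 hn.1
  have hPfin : (primitives S).Finite := (Set.finite_Iic n).subset fun x hx => hn.2 hx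
  -- Trading n for 0 keeps the cardinality and puts A inside [0, n), so j * n + a is division by n
  -- with remainder a, and the pairs (j, a) give distinct sums.
  set A : Finset ℕ := insert 0 (hPfin.toFinset.erase n) with hA
  have hAcard : A.card = (primitives S).ncard := by
    have h0 : 0 ∉ hPfin.toFinset.erase n := by
      simp only [Finset.mem_erase, Set.Finite.mem_toFinset, not_and]
      exact fun _ h => (mem_primitives.1 h).2.1 rfl
    rw [hA, Finset.card_insert_of_notMem h0,
      Finset.card_erase_add_one (by simpa using hn.1), Set.ncard_eq_toFinset_card _ hPfin]
  have hAmem : ∀ a ∈ A, a ∈ S ∧ a < n := by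
    intro a ha
    simp only [hA, Finset.mem_insert, Finset.mem_erase, Set.Finite.mem_toFinset] at ha
    rcases ha with rfl | ⟨h1, h2⟩
    · exact ⟨zero_mem S, by have := hnS.2.1; omega⟩
    · exact ⟨(mem_primitives.1 h2).1, lt_of_le_of_ne (hn.2 h2) h1⟩
  have hcard : (Finset.range q ×ˢ A).card = q * (primitives S).ncard := by
    rw [Finset.card_product, Finset.card_range, hAcard]
  rw [← hcard, ← Set.ncard_coe_finset]
  refine Set.ncard_le_ncard_of_injOn (fun p : ℕ × ℕ => p.1 * n + p.2) ?_ ?_ finite_leftElements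
  · rintro ⟨j, a⟩ hp
    simp only [Finset.mem_coe, Finset.mem_product, Finset.mem_range] at hp
    obtain ⟨haS, han⟩ := hAmem a hp.2
    refine ⟨add_mem (by simpa using S.nsmul_mem hnS.1 j) haS, lt_of_lt_of_le ?_ hq⟩
    have : (j + 1) * n ≤ q * n := Nat.mul_le_mul_right n hp.1
    have h2 : (j + 1) * n = j * n + n := by ring
    exact_mod_cast (by omega : j * n + a < q * n)
  · rintro ⟨j, a⟩ hp ⟨j', a'⟩ hp' h
    simp only [Finset.mem_coe, Finset.mem_product, Finset.mem_range] at hp hp'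
    have han := (hAmem a hp.2).2
    have han' := (hAmem a' hp'.2).2
    have hn0 : 0 < n := by omega
    simp only at h
    have h1 := congrArg (· / n) h
    have h2 := congrArg (· % n) h
    simp only [Nat.mul_add_mod_self_right, Nat.mod_eq_of_lt han, Nat.mod_eq_of_lt han'] at h2
    subst h2
    have h3 : j * n = j' * n := by omega
    rw [Nat.eq_of_mul_eq_mul_right hn0 h3]

/-- A semigroup with maximum primitive `n` that fails Wilf's inequality has few primitives, or is
cofinite below `n` with few left elements. -/
theorem few_primitives_or_few_leftElements {S : AddSubmonoid ℕ} {n : ℕ}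
    (hS : S ∈ withMaxPrimitive n) (hW : S ∉ wilf) :
    (primitives S).ncard ≤ Nat.sqrt (2 * n) ∨
      (S ≠ ⊤ ∧ frobeniusNumber S < n ∧ (leftElements S).ncard ≤ Nat.sqrt (2 * n)) := by
  obtain ⟨hall, hn⟩ := hS
  have hlt : ((primitives S).ncard : ℤ) * (leftElements S).ncard < frobeniusNumber S + 1 := by
    by_contra h
    exact hW ⟨hall, not_lt.1 h⟩
  have hT : S ≠ ⊤ := by
    rintro rfl
    have h1 : frobeniusNumber ⊤ = -1 := by simp [frobeniusNumber]
    rw [h1] at hlt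
    have : (0 : ℤ) ≤ ((primitives ⊤).ncard : ℤ) * (leftElements ⊤).ncard := by positivity
    omega
  obtain ⟨f, hf, hfS, -⟩ := exists_frobeniusNumber_eq hall hT
  have hn0 : 0 < n := Nat.pos_of_ne_zero (mem_primitives.1 hn.1).2.1
  by_contra! hcon
  obtain ⟨hP, hL⟩ := hcon
  rw [hf] at hlt
  have hlt' : (primitives S).ncard * (leftElements S).ncard < f + 1 := by exact_mod_cast hlt
  have hP2 := Nat.sqrt_lt.1 hP
  rcases lt_or_ge f n with hfn | hfn
  · have hL2 := Nat.sqrt_lt.1 (hL hT (by rw [hf]; exact_mod_cast hfn))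
    nlinarith
  -- The factor 2 under the root is needed here: 2qn ≥ (q+1)n > F because q ≥ 1.
  · have hq : f / n * n ≤ f := Nat.div_mul_le_self f n
    have h1 := mul_ncard_primitives_le_ncard_leftElements hn (q := f / n)
      (by rw [hf]; exact_mod_cast hq)
    have hq1 : 1 ≤ f / n := (Nat.one_le_div_iff hn0).2 hfn
    have h2 : f < n * (f / n + 1) := by
      have := Nat.lt_mul_div_succ f hn0
      simpa using this
    have h3 : (primitives S).ncard * (f / n * (primitives S).ncard) ≤ f :=
      (Nat.mul_le_mul_left _ h1).trans (by omega)
    have h4 : f / n * (2 * n) ≤ f / n * ((primitives S).ncard * (primitives S).ncard) :=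
      Nat.mul_le_mul_left _ hP2.le
    nlinarith

/-! ### Counting the exceptions -/

theorem primitives_injective : Function.Injective primitives := fun S T h => by
  rw [← closure_primitives S, h, closure_primitives T]

open Classical in
theorem filter_primitives_injOn (n : ℕ) :
    Set.InjOn (fun S => {x ∈ Finset.range (n + 1) | x ∈ primitives S}) (withMaxPrimitive n) := by
  intro S hS T hT h
  apply primitives_injective
  ext x
  by_cases hx : x ≤ n
  · simpa [Nat.lt_succ_iff, hx] using congrArg (x ∈ ·) h
  · exact ⟨fun h => absurd (hS.2.2 h) hx, fun h => absurd (hT.2.2 h) hx⟩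

theorem finite_withMaxPrimitive (n : ℕ) : (withMaxPrimitive n).Finite := by
  classical
  refine Set.Finite.of_injOn (t := ((Finset.range (n + 1)).powerset : Set (Finset ℕ)))
    (fun S _ => ?_) (filter_primitives_injOn n) (Finset.finite_toSet _)
  exact Finset.mem_coe.2 (Finset.mem_powerset.2 (Finset.filter_subset _ _))

theorem ncard_few_primitives_le (n k : ℕ) :
    {S ∈ withMaxPrimitive n | (primitives S).ncard ≤ k}.ncard ≤ (k + 1) * (n + 1) ^ k := by
  classical
  refine le_trans ?_ (card_powerset_filter_card_le n k)
  rw [← Set.ncard_coe_finset]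
  refine Set.ncard_le_ncard_of_injOn
    (fun S => {x ∈ Finset.range (n + 1) | x ∈ primitives S}) ?_
    ((filter_primitives_injOn n).mono fun S hS => hS.1) (Finset.finite_toSet _)
  rintro S ⟨hS, hk⟩
  simp only [Finset.coe_filter, Finset.mem_powerset, Set.mem_ofPred_eq]
  refine ⟨Finset.filter_subset _ _, le_trans ?_ hk⟩
  rw [← Set.ncard_coe_finset]
  refine Set.ncard_le_ncard (fun x hx => ?_) ((Set.finite_Iic n).subset fun x hx => hS.2.2 hx)
  simp only [Finset.coe_filter, Set.mem_ofPred_eq] at hx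
  exact hx.2

/-- F and L recover S: below F it is L, F itself is missing, and everything above F belongs. Since S
≠ ℕ, F is nonnegative and `toNat` loses nothing; the factor n + 1 counts its values. -/
theorem ncard_few_leftElements_le (n k : ℕ) :
    {S ∈ withMaxPrimitive n |
      S ≠ ⊤ ∧ frobeniusNumber S < n ∧ (leftElements S).ncard ≤ k}.ncard ≤
        (n + 1) * ((k + 1) * (n + 1) ^ k) := by
  classical
  refine le_trans ?_ (Nat.mul_le_mul_left (n + 1) (card_powerset_filter_card_le n k))
  rw [← Finset.card_range (n + 1), ← Finset.card_product, ← Set.ncard_coe_finset,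
    Finset.card_range]
  refine Set.ncard_le_ncard_of_injOn
    (fun S => ((frobeniusNumber S).toNat, {x ∈ Finset.range (n + 1) | x ∈ leftElements S}))
    ?_ ?_ (Finset.finite_toSet _)
  · rintro S ⟨hS, hT, hF, hk⟩
    simp only [Finset.coe_product, Set.mem_prod, Finset.mem_coe, Finset.mem_filter,
      Finset.mem_powerset, Finset.mem_range]
    refine ⟨by omega, Finset.filter_subset _ _, le_trans ?_ hk⟩
    rw [← Set.ncard_coe_finset]
    refine Set.ncard_le_ncard (fun x hx => ?_) finite_leftElements
    simp only [Finset.coe_filter, Set.mem_ofPred_eq] at hx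
    exact hx.2
  · rintro S ⟨hS, hST, hSF, -⟩ T ⟨hT, hTT, hTF, -⟩ h
    obtain ⟨f, hf, hfS, hfS'⟩ := exists_frobeniusNumber_eq hS.1 hST
    obtain ⟨g, hg, hgT, hgT'⟩ := exists_frobeniusNumber_eq hT.1 hTT
    simp only [Prod.mk.injEq, hf, hg, Int.toNat_natCast] at h
    obtain ⟨rfl, h⟩ := h
    rw [hf] at hSF
    have hfn : f < n := by exact_mod_cast hSF
    ext x
    rcases lt_trichotomy x f with hx | rfl | hx
    · have := congrArg (x ∈ ·) h
      simpa [leftElements, hf, hg, hx, (by omega : x < n + 1)] using this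
    · simp [hfS, hgT]
    · simp [hfS' x hx, hgT' x hx]

theorem ncard_diff_wilf_le (n : ℕ) :
    (withMaxPrimitive n \ wilf).ncard ≤
      (n + 2) * ((Nat.sqrt (2 * n) + 1) * (n + 1) ^ Nat.sqrt (2 * n)) := by
  set k := Nat.sqrt (2 * n) with hk
  have hsub : withMaxPrimitive n \ wilf ⊆
      {S ∈ withMaxPrimitive n | (primitives S).ncard ≤ k} ∪
      {S ∈ withMaxPrimitive n |
        S ≠ ⊤ ∧ frobeniusNumber S < n ∧ (leftElements S).ncard ≤ k} := by
    rintro S ⟨hS, hW⟩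
    rcases few_primitives_or_few_leftElements hS hW with h | h
    · exact Or.inl ⟨hS, h⟩
    · exact Or.inr ⟨hS, h⟩
  have hfin := finite_withMaxPrimitive n
  refine (Set.ncard_le_ncard hsub ((hfin.subset fun S hS => hS.1).union
    (hfin.subset fun S hS => hS.1))).trans ((Set.ncard_union_le _ _).trans ?_)
  have h1 := ncard_few_primitives_le n k
  have h2 := ncard_few_leftElements_le n k
  calc _ ≤ (k + 1) * (n + 1) ^ k + (n + 1) * ((k + 1) * (n + 1) ^ k) := add_le_add h1 h2
    _ = _ := by ring

/-! ### Exponentially many semigroups with maximum primitive n -/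

/-- Two generators above n/2 already sum to more than n. -/
theorem mem_or_lt_of_mem_closure {X : Set ℕ} {n x : ℕ} (hX : ∀ y ∈ X, n / 2 + 1 ≤ y)
    (hx : x ∈ AddSubmonoid.closure X) : x = 0 ∨ x ∈ X ∨ n < x := by
  induction hx using AddSubmonoid.closure_induction with
  | mem x h => exact Or.inr (Or.inl h)
  | zero => exact Or.inl rfl
  | add x y _ _ ihx ihy =>
    rcases eq_or_ne x 0 with rfl | hx0
    · simpa using ihy
    rcases eq_or_ne y 0 with rfl | hy0
    · simpa using ihx
    have hx1 : n / 2 + 1 ≤ x := by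
      rcases ihx with h | h | h
      · exact absurd h hx0
      · exact hX x h
      · omega
    have hy1 : n / 2 + 1 ≤ y := by
      rcases ihy with h | h | h
      · exact absurd h hy0
      · exact hX y h
      · omega
    omega

theorem closure_mem_all {X : Set ℕ} {n : ℕ} (h1 : n + 1 ∈ X) (h2 : n + 2 ∈ X) :
    AddSubmonoid.closure X ∈ all := by
  refine (Set.finite_Iio ((n + 1) * (n + 1))).subset fun x hx => ?_
  by_contra hlt
  simp only [Set.mem_Iio, not_lt] at hlt
  apply hx
  have hr : x % (n + 1) < n + 1 := Nat.mod_lt _ n.succ_pos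
  have hq : n + 1 ≤ x / (n + 1) := (Nat.le_div_iff_mul_le n.succ_pos).2 hlt
  -- In x = q(n+1) + r with r ≤ q, turn r copies of n+1 into n+2.
  have hx' : x = (x / (n + 1) - x % (n + 1)) • (n + 1) + (x % (n + 1)) • (n + 2) := by
    obtain ⟨d, hd⟩ := Nat.exists_eq_add_of_le (hr.le.trans hq)
    have := Nat.div_add_mod x (n + 1)
    rw [hd] at this ⊢
    simp only [smul_eq_mul, Nat.add_sub_cancel_left]
    nlinarith
  rw [hx']
  exact add_mem (AddSubmonoid.nsmul_mem _ (AddSubmonoid.subset_closure h1) _)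
    (AddSubmonoid.nsmul_mem _ (AddSubmonoid.subset_closure h2) _)

theorem closure_mem_withMaxPrimitive {X : Set ℕ} {n : ℕ}
    (hX : ∀ y ∈ X, (n + 2) / 2 + 1 ≤ y ∧ y ≤ n + 2) (h1 : n + 1 ∈ X) (h2 : n + 2 ∈ X) :
    AddSubmonoid.closure X ∈ withMaxPrimitive (n + 2) := by
  refine ⟨closure_mem_all h1 h2, mem_primitives.2
    ⟨AddSubmonoid.subset_closure h2, by omega, fun a ha b hb ha0 hb0 hab => ?_⟩,
    fun x hx => (hX x (primitives_closure_subset X hx)).2⟩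
  have key : ∀ c ∈ AddSubmonoid.closure X, c ≠ 0 → (n + 2) / 2 + 1 ≤ c := by
    intro c hc hc0
    rcases mem_or_lt_of_mem_closure (fun y hy => (hX y hy).1) hc with h | h | h
    · exact absurd h hc0
    · exact (hX c h).1
    · omega
  have := key a ha ha0
  have := key b hb hb0
  omega

theorem two_pow_le_ncard_withMaxPrimitive {n : ℕ} (hn : 4 ≤ n) :
    2 ^ (n / 2 - 2) ≤ (withMaxPrimitive n).ncard := by
  obtain ⟨m, rfl⟩ := Nat.exists_eq_add_of_le' (show 2 ≤ n by omega)
  -- With n = m + 2, these are the free generators; n - 1 and n are always included, and being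
  -- consecutive they ensure a finite complement.
  set I := Finset.Ico ((m + 2) / 2 + 1) (m + 1) with hI
  have hcard : 2 ^ ((m + 2) / 2 - 2) ≤ I.powerset.card := by
    rw [Finset.card_powerset, hI, Nat.card_Ico]
    exact Nat.pow_le_pow_right two_pos (by omega)
  refine hcard.trans ?_
  rw [← Set.ncard_coe_finset]
  have hX : ∀ T ∈ (I.powerset : Set (Finset ℕ)), ∀ y ∈ (T : Set ℕ) ∪ {m + 1, m + 2},
      (m + 2) / 2 + 1 ≤ y ∧ y ≤ m + 2 := by
    intro T hT y hy
    simp only [Finset.coe_powerset, Set.mem_preimage, Set.mem_powerset_iff, Finset.coe_subset]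
      at hT
    rcases hy with hy | rfl | rfl
    · have := hT hy
      rw [hI, Finset.mem_Ico] at this
      omega
    · omega
    · omega
  have hmem : ∀ T ∈ (I.powerset : Set (Finset ℕ)), ∀ x ∈ I,
      (x ∈ AddSubmonoid.closure ((T : Set ℕ) ∪ {m + 1, m + 2}) ↔ x ∈ T) := by
    intro T hT x hx
    rw [hI, Finset.mem_Ico] at hx
    refine ⟨fun h => ?_, fun h => AddSubmonoid.subset_closure (Or.inl h)⟩
    rcases mem_or_lt_of_mem_closure (fun y hy => (hX T hT y hy).1) h with h | h | h
    · omega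
    · rcases h with h | rfl | rfl
      · exact h
      · omega
      · omega
    · omega
  refine Set.ncard_le_ncard_of_injOn
    (fun T : Finset ℕ => AddSubmonoid.closure ((T : Set ℕ) ∪ {m + 1, m + 2}))
    (fun T hT => closure_mem_withMaxPrimitive (hX T hT) (by simp) (by simp)) ?_
    (finite_withMaxPrimitive _)
  intro T hT T' hT' h
  ext x
  by_cases hx : x ∈ I
  · rw [← hmem T hT x hx, ← hmem T' hT' x hx]
    exact congrArg (x ∈ ·) h |>.to_iff
  · have hT2 := hT
    have hT3 := hT'
    simp only [Finset.coe_powerset, Set.mem_preimage, Set.mem_powerset_iff, Finset.coe_subset]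
      at hT2 hT3
    exact ⟨fun h => absurd (hT2 h) hx, fun h => absurd (hT3 h) hx⟩

/-! ### Asymptotic comparison -/

open Filter Topology

theorem eventually_bound_le_exp :
    ∀ᶠ n : ℕ in atTop,
      (((n + 2) * ((Nat.sqrt (2 * n) + 1) * (n + 1) ^ Nat.sqrt (2 * n)) : ℕ) : ℝ) ≤
        Real.exp (n / 8) := by
  -- The constant 1/64 gives log(n+2) ≤ 2 log n ≤ √n/32; with k + 2 ≤ 4√n the exponent is at most
  -- n/8.
  have hlog := ((isLittleO_log_rpow_atTop (r := 1 / 2) (by norm_num)).comp_tendsto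
    tendsto_natCast_atTop_atTop).bound (show (0 : ℝ) < 1 / 64 by norm_num)
  filter_upwards [hlog, eventually_ge_atTop 2] with n hn hn2
  set k := Nat.sqrt (2 * n) with hk
  have hn2' : (2 : ℝ) ≤ n := by exact_mod_cast hn2
  simp only [Function.comp_apply, Real.norm_eq_abs, ← Real.sqrt_eq_rpow] at hn
  rw [abs_of_nonneg (Real.log_nonneg (by linarith)), abs_of_nonneg (Real.sqrt_nonneg _)] at hn
  have hs : Real.sqrt n * Real.sqrt n = n := Real.mul_self_sqrt (by linarith)
  have hs1 : 1 ≤ Real.sqrt n := Real.one_le_sqrt.2 (by linarith)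
  have hks : (k : ℝ) ≤ 2 * Real.sqrt n := by
    have h : k * k ≤ 2 * n := Nat.sqrt_le _
    have h' : (k : ℝ) * k ≤ 2 * n := by exact_mod_cast h
    nlinarith
  have hpow : (n + 2) * ((k + 1) * (n + 1) ^ k) ≤ (n + 2) ^ (k + 2) := by
    have hkn : k ≤ n := by
      have h : k * k ≤ 2 * n := Nat.sqrt_le _
      nlinarith
    calc (n + 2) * ((k + 1) * (n + 1) ^ k) ≤ (n + 2) * ((n + 2) * (n + 2) ^ k) := by
          gcongr <;> omega
      _ = (n + 2) ^ (k + 2) := by ring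
  have hl : Real.log (n + 2) ≤ 2 * Real.log n := by
    rw [← Nat.cast_ofNat (n := 2), ← Real.log_pow]
    exact Real.log_le_log (by positivity) (by push_cast; nlinarith)
  calc _ ≤ (((n + 2) ^ (k + 2) : ℕ) : ℝ) := by exact_mod_cast hpow
    _ = Real.exp ((k + 2) * Real.log (n + 2)) := by
      rw [mul_comm, Real.exp_mul, Real.exp_log (by positivity)]
      norm_cast
    _ ≤ Real.exp (n / 8) := by
      refine Real.exp_le_exp.2 ?_
      calc ((k : ℝ) + 2) * Real.log (n + 2)
          ≤ (4 * Real.sqrt n) * (1 / 32 * Real.sqrt n) := by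
            refine mul_le_mul (by linarith) (by linarith)
              (Real.log_nonneg (by linarith)) (by positivity)
        _ = n / 8 := by linear_combination hs / 8

theorem tendsto_ncard_diff_wilf_div :
    Tendsto (fun n : ℕ => ((withMaxPrimitive n \ wilf).ncard : ℝ) / (withMaxPrimitive n).ncard)
      atTop (𝓝 0) := by
  have hlim : Tendsto (fun n : ℕ => Real.exp (3 - (n : ℝ) / 8)) atTop (𝓝 0) := by
    refine Real.tendsto_exp_atBot.comp (tendsto_atBot_add_const_left _ 3 ?_)
    exact tendsto_neg_atTop_atBot.comp
      (tendsto_natCast_atTop_atTop.atTop_div_const (by norm_num : (0 : ℝ) < 8))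
  refine squeeze_zero' (Eventually.of_forall fun n => by positivity) ?_ hlim
  filter_upwards [eventually_bound_le_exp, eventually_ge_atTop 4] with n hn hn4
  -- From log 2 > 1/2 and ⌊n/2⌋ - 2 ≥ (n-5)/2; the rate 1/4 beats the 1/8 of the exceptions.
  have hA : Real.exp (n / 4 - 3) ≤ (withMaxPrimitive n).ncard := by
    have h1 : ((2 ^ (n / 2 - 2) : ℕ) : ℝ) ≤ (withMaxPrimitive n).ncard := by
      exact_mod_cast two_pow_le_ncard_withMaxPrimitive hn4
    refine le_trans ?_ h1
    have h2 : ((2 ^ (n / 2 - 2) : ℕ) : ℝ) = Real.exp ((n / 2 - 2 : ℕ) * Real.log 2) := by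
      rw [mul_comm, Real.exp_mul, Real.exp_log two_pos, Real.rpow_natCast]
      norm_cast
    rw [h2]
    refine Real.exp_le_exp.2 ?_
    have h3 : (n : ℝ) ≤ 2 * ((n / 2 - 2 : ℕ) : ℝ) + 5 := by
      exact_mod_cast (by omega : n ≤ 2 * (n / 2 - 2) + 5)
    have h4 := Real.log_two_gt_d9
    have h5 : (0 : ℝ) ≤ ((n / 2 - 2 : ℕ) : ℝ) := by positivity
    nlinarith
  have hB : ((withMaxPrimitive n \ wilf).ncard : ℝ) ≤ Real.exp (n / 8) :=
    le_trans (by exact_mod_cast ncard_diff_wilf_le n) hn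
  calc _ ≤ Real.exp (n / 8) / Real.exp (n / 4 - 3) := by gcongr
    _ = Real.exp (3 - n / 8) := by rw [← Real.exp_sub]; congr 1; ring

theorem tendsto_probMaxPrimitive_wilf :
    Tendsto (fun n : ℕ => probMaxPrimitive n wilf) atTop (𝓝 1) := by
  have h := tendsto_ncard_diff_wilf_div.const_sub 1
  rw [sub_zero] at h
  refine h.congr' ?_
  filter_upwards [eventually_ge_atTop 4] with n hn
  have hpos : 0 < (withMaxPrimitive n).ncard :=
    lt_of_lt_of_le (by positivity) (two_pow_le_ncard_withMaxPrimitive hn)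
  have hadd := Set.ncard_inter_add_ncard_sdiff_eq_ncard (withMaxPrimitive n) wilf
    (finite_withMaxPrimitive n)
  rw [Set.inter_comm] at hadd
  have hadd' : ((wilf ∩ withMaxPrimitive n).ncard : ℝ) + (withMaxPrimitive n \ wilf).ncard =
      (withMaxPrimitive n).ncard := by exact_mod_cast hadd
  have hne : ((withMaxPrimitive n).ncard : ℝ) ≠ 0 := by exact_mod_cast hpos.ne'
  rw [probMaxPrimitive, eq_div_iff hne, sub_mul, div_mul_cancel₀ _ hne]
  linarith

theorem wilf_inter_withMaxPrimitive (n : ℕ) :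
    wilf ∩ withMaxPrimitive n = {S | S ∈ withMaxPrimitive n ∧
      ((primitives S).ncard : ℤ) * ((leftElements S).ncard : ℤ) > frobeniusNumber S} := by
  ext S
  simp only [wilf, Set.mem_inter_iff, Set.mem_ofPred_eq, ge_iff_le, gt_iff_lt, Int.add_one_le_iff]
  exact ⟨fun h => ⟨h.2, h.1.2⟩, fun h => ⟨⟨h.1.1, h.2⟩, h.1⟩⟩

end NumericalSemigroup

theorem mainTheorem4 :
    Filter.Tendsto
        (fun n : ℕ => NumericalSemigroup.probMaxPrimitive n NumericalSemigroup.wilf)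
        Filter.atTop (nhds (1 : ℝ)) ∧
      Filter.Tendsto
        (fun n : ℕ =>
          (({S : AddSubmonoid ℕ | S ∈ NumericalSemigroup.withMaxPrimitive n ∧
              ((NumericalSemigroup.primitives S).ncard : ℤ) *
                ((NumericalSemigroup.leftElements S).ncard : ℤ) >
                  NumericalSemigroup.frobeniusNumber S}).ncard : ℝ) /
            ((NumericalSemigroup.withMaxPrimitive n).ncard : ℝ))
        Filter.atTop (nhds (1 : ℝ)) := by
  refine ⟨NumericalSemigroup.tendsto_probMaxPrimitive_wilf, ?_⟩
  simp only [← NumericalSemigroup.wilf_inter_withMaxPrimitive]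
  exact NumericalSemigroup.tendsto_probMaxPrimitive_wilf
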